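/- Let $J\ge 0$ be an integer and let $\mathcal A\subset\mathbb C$ be a finite set such that $\alpha-\alpha'\in\mathbb Z$ with $\alpha,\alpha'\in\mathcal A$ implies $\alpha=\alpha'$. For every $(\alpha,j)\in\mathcal A\times\{0,\dots,J\}$ let $K(\alpha,j)$ be a non-negative integer, let $(f_{\alpha,j,k})_{1\le k\le K(\alpha,j)}$ be functions holomorphic at $0$ whose Taylor coefficients at $0$ are algebraic numbers, and let $(\lambda_{\alpha,j,k})_{1\le k\le K(\alpha,j)}$ be complex numbers linearly independent over $\overline{\mathbb Q}$ (the field of algebraic numbers in $\mathbb C$). Let $r>0$ be such that all the $f_{\alpha,j,k}$ are holomorphic on the disc $D=\{|z|<r\}$, let $U\subset D\setminus\{0\}$ be a non-empty connected open set on which a determination of $\log(z)$ exists, fix any such determination, and put $z^\alpha=\exp(\alpha\log(z))$ on $U$. A holomorphic function on an open set is called holonomic there if it satisfies a non-zero homogeneous linear differential equation with coefficients in $\mathbb C(z)$ (equivalently, after clearing denominators, with coefficients in $\mathbb C[z]$). Then the function $$f(z)=\sum_{\alpha\in\mathcal A}\sum_{j=0}^{J}\sum_{k=1}^{K(\alpha,j)}\lambda_{\alpha,j,k}\,z^{\alpha}\log(z)^{j}f_{\alpha,j,k}(z)$$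 is holonomic on $U$ if and only if every function $f_{\alpha,j,k}$ is holonomic on $D$. -/

import Mathlib

/-- `g` is holonomic on the open set `U`: it is holomorphic on `U` and is a solution there of a
non-zero homogeneous linear differential equation
`p₀(z) y(z) + p₁(z) y'(z) + ⋯ + pₙ(z) y⁽ⁿ⁾(z) = 0` over `ℂ(z)`; denominators are cleared, so that
the coefficients are polynomials, not all of them zero. -/
def IsHolonomicOn (g : ℂ → ℂ) (U : Set ℂ) : Prop :=
  AnalyticOnNhd ℂ g U ∧
    ∃ (n : ℕ) (p : ℕ → Polynomial ℂ), (∃ i ≤ n, p i ≠ 0) ∧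
      ∀ z ∈ U, ∑ i ∈ Finset.range (n + 1), (p i).eval z * iteratedDeriv i g z = 0

/-- `ℓ` is a determination of the logarithm on `U` (in particular `0 ∉ U`). -/
def IsLogDetermination (ℓ : ℂ → ℂ) (U : Set ℂ) : Prop :=
  ContinuousOn ℓ U ∧ ∀ z ∈ U, Complex.exp (ℓ z) = z

/-!
Holonomy of a function on a domain is a property of its Taylor series at any point `z₀`: it holds if
and only if that series is D-finite (`isHolonomicOn_iff_dfinite_taylorSeries`). A power series is
D-finite if and only if its derivatives span a finite-dimensional `ℂ(X)`-space of Laurent series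
(`PowerSeries.dfinite_iff_exists_finiteDimensional`), so holonomic functions are closed under sums and
products, and holonomy passes from a domain to any larger domain of holomorphy. As `z ^ α` and `log z`
are holonomic, this gives one direction.

For the other direction, write the function as `F (log z)`, with
`F w = ∑ exp (α w) * w ^ j * g α j (exp w)` on a left half-plane and `g α j = ∑ k, lam α j k * f α j k`.
A linear differential equation for one branch holds for all of them
(`IsHolonomicOn.comp_log_of_comp_log`). The branch obtained after `n` turns around `0` is a
combination of the sequences `μ ^ n * n ^ i`, where `μ = exp (2 * π * I * α)`; as the exponents are
distinct modulo `ℤ` these sequences are linearly independent (`linearIndependent_pow_mul_pow`), and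
their coefficients are finite linear combinations of branches, hence holonomic. The system which
expresses them in terms of the `g α j` is triangular, so every `g α j` is holonomic
(`isHolonomicOn_of_logSum`).

It remains to separate the `f α j k` in `g α j`. The automorphisms `σ` of `ℂ` over the field of
algebraic numbers fix the Taylor coefficients of the `f α j k` and preserve D-finiteness, so all the
`∑ k, σ (lam α j k) * f α j k` are D-finite. The fixed field of these automorphisms is the field of
algebraic numbers, so by Artin's independence theorem the `f α j k` are linear combinations of these
conjugates (`PowerSeries.DFinite.of_sum_C_mul`).
-/

open Filter Topology

/-! ### D-finite power series -/

open Polynomial in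
/-- A power series `y` is D-finite if it satisfies a non-zero homogeneous linear differential
equation with polynomial coefficients. -/
def PowerSeries.DFinite {E : Type*} [Field E] (y : PowerSeries E) : Prop :=
  ∃ (n : ℕ) (p : ℕ → E[X]), (∃ i ≤ n, p i ≠ 0) ∧
    ∑ i ∈ Finset.range (n + 1), (p i : PowerSeries E) * (derivative E)^[i] y = 0

namespace PowerSeries

open scoped Polynomial LaurentSeries RatFunc

variable {E : Type*} [Field E]

theorem algebraMap_polynomial_eq_coe (p : E[X]) : algebraMap E[X] E⟦X⟧ p = p := by
  ext n
  simp [algebraMap_apply']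

theorem polynomial_smul_eq_coe_mul (p : E[X]) (y : E⟦X⟧) : p • y = (p : E⟦X⟧) * y := by
  rw [Algebra.smul_def, algebraMap_polynomial_eq_coe]

/-- The derivatives of order `< n` of `y` span a `E[X]`-module which the derivation sends into the
one spanned by those of order `< n + 1`. -/
theorem derivative_mem_span_iterate {y x : E⟦X⟧} {n : ℕ}
    (hx : x ∈ Submodule.span E[X] ((fun i => (derivative E)^[i] y) '' Set.Iio n)) :
    derivative E x ∈ Submodule.span E[X] ((fun i => (derivative E)^[i] y) '' Set.Iio (n + 1)) := by
  have mono : Submodule.span E[X] ((fun i => (derivative E)^[i] y) '' Set.Iio n) ≤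
      Submodule.span E[X] ((fun i => (derivative E)^[i] y) '' Set.Iio (n + 1)) :=
    Submodule.span_mono (Set.image_mono (Set.Iio_subset_Iio (Nat.le_succ n)))
  induction hx using Submodule.span_induction with
  | mem x hx =>
    obtain ⟨i, hi, rfl⟩ := hx
    refine Submodule.subset_span ⟨i + 1, by simpa using hi, ?_⟩
    simp only [Function.iterate_succ_apply']
  | zero => simp
  | add a b _ _ ha hb => rw [map_add]; exact add_mem ha hb
  | smul p a ha' ha =>
    have : derivative E (p • a) = p.derivative • a + p • derivative E a := by
      rw [polynomial_smul_eq_coe_mul, Derivation.leibniz, derivative_coe,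
        polynomial_smul_eq_coe_mul, polynomial_smul_eq_coe_mul, smul_eq_mul, smul_eq_mul]
      ring
    rw [this]
    exact add_mem (Submodule.smul_mem _ _ (mono ha')) (Submodule.smul_mem _ _ ha)

/-- A power series is D-finite if and only if its derivatives stay in a finite-dimensional
`E(X)`-subspace of the field of Laurent series. -/
theorem dfinite_iff_exists_finiteDimensional {y : E⟦X⟧} :
    DFinite y ↔ ∃ V : Submodule (RatFunc E) E⸨X⸩, FiniteDimensional (RatFunc E) V ∧
      ∀ n, algebraMap E⟦X⟧ E⸨X⸩ ((derivative E)^[n] y) ∈ V := by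
  classical
  have smul_eq (p : E[X]) (x : E⟦X⟧) : algebraMap E⟦X⟧ E⸨X⸩ ((p : E⟦X⟧) * x) =
      algebraMap E[X] (RatFunc E) p • algebraMap E⟦X⟧ E⸨X⸩ x := by
    rw [algebraMap_smul, Algebra.smul_def, map_mul]
    congr 1
  constructor
  · rintro ⟨n, p, ⟨i₀, hi₀, hp₀⟩, h⟩
    -- `N` is the order of the equation: its highest index with a non-zero coefficient
    set N := Nat.findGreatest (fun i => p i ≠ 0) n with hN
    have hpN : p N ≠ 0 := Nat.findGreatest_spec (P := fun i => p i ≠ 0) hi₀ hp₀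
    have hNn : N ≤ n := Nat.findGreatest_le n
    have h0 : ∀ i, N < i → i ≤ n → p i = 0 := fun i h1 h2 => by
      simpa using Nat.findGreatest_is_greatest h1 h2
    set M : ℕ → Submodule E[X] E⟦X⟧ := fun m =>
      Submodule.span E[X] ((fun i => (derivative E)^[i] y) '' Set.Iio m) with hM
    have hmem (i m : ℕ) (hi : i < m) : (derivative E)^[i] y ∈ M m :=
      Submodule.subset_span ⟨i, hi, rfl⟩
    have key (k : ℕ) : p N • (derivative E)^[N + k] y ∈ M (N + k) := by
      induction k with
      | zero =>
        have h' : ∑ i ∈ Finset.range (N + 1), (p i : E⟦X⟧) * (derivative E)^[i] y = 0 := by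
          rw [← h]
          refine Finset.sum_subset (by simpa using hNn) fun i hi hi' => ?_
          rw [h0 i (by simpa using hi') (by simpa [Nat.lt_succ_iff] using hi)]
          simp
        rw [Finset.sum_range_succ] at h'
        rw [add_zero, polynomial_smul_eq_coe_mul, eq_neg_of_add_eq_zero_right h']
        refine neg_mem (sum_mem fun i hi => ?_)
        rw [← polynomial_smul_eq_coe_mul]
        exact Submodule.smul_mem _ _ (hmem i N (by simpa using hi))
      | succ k ih =>
        have := derivative_mem_span_iterate ih
        rw [polynomial_smul_eq_coe_mul, Derivation.leibniz, derivative_coe, smul_eq_mul,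
          smul_eq_mul, mul_comm _ ((Polynomial.derivative (p N) : E[X]) : E⟦X⟧),
          ← polynomial_smul_eq_coe_mul, ← polynomial_smul_eq_coe_mul] at this
        have h2 : Polynomial.derivative (p N) • (derivative E)^[N + k] y ∈ M (N + k + 1) :=
          Submodule.smul_mem _ _ (hmem _ _ (Nat.lt_succ_self _))
        rw [← add_assoc, Function.iterate_succ_apply']
        exact (Submodule.add_mem_iff_left _ h2).1 this
    refine ⟨Submodule.span (RatFunc E) ((fun i => algebraMap E⟦X⟧ E⸨X⸩ ((derivative E)^[i] y)) ''
      Set.Iio N), FiniteDimensional.span_of_finite _ ((Set.finite_Iio N).image _), fun m => ?_⟩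
    induction m using Nat.strong_induction_on with
    | _ m ih =>
    rcases lt_or_ge m N with hm | hm
    · exact Submodule.subset_span ⟨m, hm, rfl⟩
    obtain ⟨k, rfl⟩ := Nat.exists_eq_add_of_le hm
    set V := Submodule.span (RatFunc E)
      ((fun i => algebraMap E⟦X⟧ E⸨X⸩ ((derivative E)^[i] y)) '' Set.Iio N)
    have hle : ∀ x ∈ M (N + k), algebraMap E⟦X⟧ E⸨X⸩ x ∈ V := by
      intro x hx
      induction hx using Submodule.span_induction with
      | mem x hx =>
        obtain ⟨i, hi, rfl⟩ := hx
        exact ih i hi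
      | zero => simp
      | add a b _ _ ha hb => rw [map_add]; exact add_mem ha hb
      | smul p a _ ha =>
        rw [polynomial_smul_eq_coe_mul, smul_eq]
        exact Submodule.smul_mem _ _ ha
    have := hle _ (key k)
    rw [polynomial_smul_eq_coe_mul, smul_eq] at this
    refine (Submodule.smul_mem_iff _ ?_).1 this
    simpa using hpN
  · rintro ⟨V, hV, h⟩
    set d := Module.finrank (RatFunc E) V with hd
    let v : Fin (d + 1) → V := fun i => ⟨_, h i⟩
    have hv : ¬ LinearIndependent (RatFunc E) v := fun hli => by
      have := hli.fintype_card_le_finrank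
      simp [← hd] at this
    have hv' : ¬ LinearIndependent (RatFunc E)
        (fun i : Fin (d + 1) => algebraMap E⟦X⟧ E⸨X⸩ ((derivative E)^[i] y)) := fun hli =>
      hv (LinearIndependent.of_comp V.subtype hli)
    rw [← LinearIndependent.iff_fractionRing E[X] (RatFunc E), Fintype.not_linearIndependent_iff]
      at hv'
    obtain ⟨g, hg, i, hi⟩ := hv'
    refine ⟨d, fun i => if hi : i < d + 1 then g ⟨i, hi⟩ else 0,
      ⟨i, Nat.lt_succ_iff.1 i.2, by simpa only [dif_pos i.2] using hi⟩, ?_⟩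
    apply FaithfulSMul.algebraMap_injective E⟦X⟧ E⸨X⸩
    rw [map_zero, ← hg, map_sum, Finset.sum_range]
    refine Finset.sum_congr rfl fun i _ => ?_
    rw [smul_eq, algebraMap_smul]
    simp only [dif_pos i.2]

theorem DFinite.add {y z : E⟦X⟧} (hy : DFinite y) (hz : DFinite z) : DFinite (y + z) := by
  rw [dfinite_iff_exists_finiteDimensional] at *
  obtain ⟨V, hV, hyV⟩ := hy
  obtain ⟨W, hW, hzW⟩ := hz
  refine ⟨V ⊔ W, inferInstance, fun n => ?_⟩
  rw [iterate_map_add, map_add]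
  exact Submodule.add_mem_sup (hyV n) (hzW n)

theorem DFinite.mul {y z : E⟦X⟧} (hy : DFinite y) (hz : DFinite z) : DFinite (y * z) := by
  rw [dfinite_iff_exists_finiteDimensional] at *
  obtain ⟨V, hV, hyV⟩ := hy
  obtain ⟨W, hW, hzW⟩ := hz
  refine ⟨V * W, ?_, fun n => ?_⟩
  · exact Module.Finite.iff_fg.2
      ((Module.Finite.iff_fg.1 hV).mul (Module.Finite.iff_fg.1 hW))
  suffices ∀ n i j, algebraMap E⟦X⟧ E⸨X⸩ ((derivative E)^[n]
      ((derivative E)^[i] y * (derivative E)^[j] z)) ∈ V * W from this n 0 0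
  intro n
  induction n with
  | zero =>
    intro i j
    rw [Function.iterate_zero, id, map_mul]
    exact Submodule.mul_mem_mul (hyV i) (hzW j)
  | succ n ih =>
    intro i j
    rw [Function.iterate_succ_apply, Derivation.leibniz, iterate_map_add, map_add, smul_eq_mul,
      smul_eq_mul, mul_comm ((derivative E)^[j] z), ← Function.iterate_succ_apply' (derivative E) j,
      ← Function.iterate_succ_apply' (derivative E) i]
    exact add_mem (ih _ _) (ih _ _)

theorem dfinite_C (c : E) : DFinite (C c) := by
  refine ⟨1, fun i => if i = 1 then 1 else 0, ⟨1, le_rfl, by simp⟩, ?_⟩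
  simp [Finset.sum_range_succ]

theorem dfinite_sum {ι : Type*} (s : Finset ι) (y : ι → E⟦X⟧) (h : ∀ i ∈ s, DFinite (y i)) :
    DFinite (∑ i ∈ s, y i) :=
  Finset.sum_induction _ DFinite (fun _ _ => DFinite.add) (by simpa using dfinite_C (0 : E)) h

/-- Applying a field endomorphism to the coefficients of a D-finite power series, and to those of
its equation, gives a D-finite power series. -/
theorem DFinite.map {y : E⟦X⟧} (hy : DFinite y) (σ : E →+* E) : DFinite (map σ y) := by
  obtain ⟨n, p, ⟨i, hi, hp⟩, h⟩ := hy
  refine ⟨n, fun i => (p i).map σ, ⟨i, hi, (Polynomial.map_ne_zero_iff σ.injective).2 hp⟩, ?_⟩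
  have hd (x : E⟦X⟧) : derivative E (PowerSeries.map σ x) = PowerSeries.map σ (derivative E x) := by
    ext n
    simp [coeff_derivative]
  have hd' (i : ℕ) : (derivative E)^[i] (PowerSeries.map σ y) =
      PowerSeries.map σ ((derivative E)^[i] y) :=
    ((Function.Semiconj.iterate_right (f := PowerSeries.map σ) (fun x => (hd x).symm) i) y).symm
  rw [← map_zero (PowerSeries.map σ), ← h, map_sum]
  refine Finset.sum_congr rfl fun i _ => ?_
  rw [hd', map_mul, Polynomial.polynomial_map_coe]

end PowerSeries

/-! ### Interpolation and exponential polynomials -/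

/-- Finitely many linearly independent functions can be interpolated: some finite combination of
evaluations takes prescribed values on them. Otherwise the vectors of values would lie in a
hyperplane, whose equation is a linear relation between the functions. -/
theorem LinearIndependent.exists_finsupp_eval_eq {k ι S : Type*} [Field k] [Finite ι]
    {v : ι → S → k} (hv : LinearIndependent k v) (w : ι → k) :
    ∃ c : S →₀ k, ∀ i, c.sum (fun s a => a * v i s) = w i := by
  classical
  have := Fintype.ofFinite ι
  have htop : Submodule.span k (Set.range fun s i => v i s) = ⊤ := by
    by_contra hne
    obtain ⟨φ, hφ, hle⟩ := Submodule.exists_le_ker_of_lt_top _ (lt_top_iff_ne_top.2 hne)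
    refine hφ (LinearMap.pi_ext' fun i => LinearMap.ext_ring ?_)
    have h0 : ∑ i, φ (Pi.single i 1) • v i = 0 := by
      funext s
      have h1 : φ (fun i => v i s) = 0 := hle (Submodule.subset_span ⟨s, rfl⟩)
      rw [LinearMap.pi_apply_eq_sum_univ φ] at h1
      rw [Finset.sum_apply, Pi.zero_apply, ← h1]
      refine Finset.sum_congr rfl fun i _ => ?_
      rw [Pi.smul_apply, smul_eq_mul, smul_eq_mul, mul_comm]
      congr 2
      funext j
      simp [Pi.single_apply, eq_comm]
    simpa using Fintype.linearIndependent_iff.1 hv _ h0 i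
  have hw : w ∈ Submodule.span k (Set.range fun s i => v i s) := htop ▸ Submodule.mem_top
  obtain ⟨c, hc⟩ := (Finsupp.mem_span_range_iff_exists_finsupp).1 hw
  refine ⟨c, fun i => ?_⟩
  rw [← hc, Finsupp.sum_apply']
  rfl

open Module.End in
/-- The exponential polynomial `μ ^ n * P n` is a generalized eigenvector of the shift
`u ↦ (n ↦ u (n + 1))` for `μ`: applying `shift - μ` replaces `P` by a multiple of `P (n + 1) - P n`,
whose degree is smaller. -/
theorem pow_mul_eval_mem_maxGenEigenspace (μ : ℂ) (P : Polynomial ℂ) :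
    (fun n : ℕ => μ ^ n * P.eval (n : ℂ)) ∈
      maxGenEigenspace (LinearMap.funLeft ℂ ℂ (fun n : ℕ => n + 1)) μ := by
  induction hd : P.degree using WellFoundedLT.induction generalizing P with
  | _ d ih =>
  subst hd
  rcases eq_or_ne P 0 with rfl | hP
  · simp only [Polynomial.eval_zero, mul_zero]
    exact zero_mem _
  set Q := Polynomial.taylor 1 P - P with hQ
  have hdeg : Q.degree < P.degree := by
    rw [← Polynomial.degree_taylor P 1]
    exact Polynomial.degree_sub_lt_left (Polynomial.degree_taylor P 1)
      (by simpa using hP) (by simp)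
  obtain ⟨k, hk⟩ := (mem_maxGenEigenspace _ _ _).1 (Submodule.smul_mem _ μ (ih _ hdeg Q rfl))
  refine (mem_maxGenEigenspace _ _ _).2 ⟨k + 1, ?_⟩
  rw [pow_succ, Module.End.mul_apply, ← hk]
  congr 1
  funext n
  simp [hQ, LinearMap.funLeft, Polynomial.taylor_eval]
  ring

open Module.End in
theorem linearIndependent_pow_mul_pow {A : Type*} [Fintype A] (μ : A → ℂ)
    (hinj : Function.Injective μ) (h0 : ∀ a, μ a ≠ 0) (J : ℕ) :
    LinearIndependent ℂ
      (fun (x : A × Fin J) (n : ℕ) => μ x.1 ^ n * (n : ℂ) ^ (x.2 : ℕ)) := by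
  rw [Fintype.linearIndependent_iff]
  rintro g hg ⟨a, j⟩
  let P : A → Polynomial ℂ := fun a => ∑ j : Fin J, Polynomial.C (g (a, j)) * Polynomial.X ^ (j : ℕ)
  have hP : ∑ a, (fun n : ℕ => μ a ^ n * (P a).eval (n : ℂ)) = 0 := by
    rw [← hg, Fintype.sum_prod_type]
    refine Finset.sum_congr rfl fun a _ => ?_
    funext n
    simp only [P, Polynomial.eval_finsetSum, Finset.mul_sum, Finset.sum_apply, Pi.smul_apply,
      Polynomial.eval_mul, Polynomial.eval_C, Polynomial.eval_pow, Polynomial.eval_X, smul_eq_mul]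
    exact Finset.sum_congr rfl fun j _ => by ring
  have ind := (independent_maxGenEigenspace (LinearMap.funLeft ℂ ℂ (fun n : ℕ => n + 1))).comp hinj
  have hz : P a = 0 := by
    have h1 := (iSupIndep_iff_finsetSum_eq_zero_imp_eq_zero _).1 ind Finset.univ _ (fun a _ =>
      pow_mul_eval_mem_maxGenEigenspace (μ a) (P a)) hP a (Finset.mem_univ a)
    refine Polynomial.eq_zero_of_infinite_isRoot _ (Set.Infinite.mono ?_
      (Set.infinite_range_of_injective (Nat.cast_injective (R := ℂ))))
    rintro _ ⟨n, rfl⟩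
    have := congrFun h1 n
    simpa [h0 a] using this
  have := congrArg (fun p => Polynomial.coeff p (j : ℕ)) hz
  simpa [P, Polynomial.finsetSum_coeff, Polynomial.coeff_X_pow, Fin.val_inj] using this

/-! ### Automorphisms of an algebraically closed field and descent of D-finiteness -/

/-- Complete `x` to a transcendence basis; translating the basis by `1` is an automorphism of the
polynomial ring which it generates, and it extends to the algebraic closure `E`. -/
theorem exists_algEquiv_ne_of_transcendental {F E : Type*} [Field F] [Field E] [Algebra F E]
    [IsAlgClosed E] {x : E} (hx : Transcendental F x) : ∃ σ : E ≃ₐ[F] E, σ x ≠ x := by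
  obtain ⟨s, hxs, hs⟩ := exists_isTranscendenceBasis_superset (R := F) (s := {x})
    ((algebraicIndependent_singleton_iff (⟨x, rfl⟩ : ({x} : Set E))).2 hx)
  have hx' : x ∈ s := hxs rfl
  have := IsAlgClosed.isAlgClosure_of_transcendence_basis _ hs
  let τ : MvPolynomial s F ≃ₐ[F] MvPolynomial s F := AlgEquiv.ofAlgHom
    (MvPolynomial.aeval fun i => MvPolynomial.X i + 1)
    (MvPolynomial.aeval fun i => MvPolynomial.X i - 1) (by ext; simp) (by ext; simp)
  let e : Algebra.adjoin F (Set.range ((↑) : s → E)) ≃ₐ[F] Algebra.adjoin F (Set.range ((↑) : s → E)) :=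
    (hs.1.aevalEquiv.symm.trans τ).trans hs.1.aevalEquiv
  let σ := IsAlgClosure.equivOfEquiv E E e.toRingEquiv
  have hσ (a) : σ (algebraMap _ E a) = algebraMap _ E (e a) :=
    IsAlgClosure.equivOfEquiv_algebraMap E E e.toRingEquiv a
  refine ⟨AlgEquiv.ofRingEquiv (f := σ) fun c => ?_, ?_⟩
  · have := hσ (algebraMap F _ c)
    simpa using this
  · have h1 := hσ (hs.1.aevalEquiv (MvPolynomial.X ⟨x, hx'⟩))
    simp [e, τ] at h1
    simp [h1]


theorem mem_algebraicClosure_of_forall_algEquiv {F E : Type*} [Field F] [Field E] [Algebra F E]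
    [IsAlgClosed E] {x : E} (hx : ∀ σ : E ≃ₐ[algebraicClosure F E] E, σ x = x) :
    x ∈ algebraicClosure F E := by
  by_contra h
  have ht : Transcendental (algebraicClosure F E) x := fun ha =>
    h (mem_algebraicClosure_iff.2 (ha.restrictScalars F))
  obtain ⟨σ, hσ⟩ := exists_algEquiv_ne_of_transcendental ht
  exact hσ (hx σ)

/-- Dedekind–Artin independence, over the fixed field `algebraicClosure F E` of the automorphism
group: elements linearly independent over the fixed field have linearly independent orbit maps. -/
theorem linearIndependent_algEquiv_apply {F E ι : Type*} [Field F] [Field E] [Algebra F E]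
    [IsAlgClosed E] [Finite ι] {v : ι → E} (hv : LinearIndependent (algebraicClosure F E) v) :
    LinearIndependent E (fun i (σ : E ≃ₐ[algebraicClosure F E] E) => σ (v i)) := by
  classical
  have := Fintype.ofFinite ι
  have h1 : LinearIndependent (FixedPoints.subfield (E ≃ₐ[algebraicClosure F E] E) E) v := by
    rw [Fintype.linearIndependent_iff] at hv ⊢
    intro g hg i
    have := hv (fun i => ⟨g i, mem_algebraicClosure_of_forall_algEquiv fun σ => (g i).2 σ⟩) hg i
    exact Subtype.ext (congrArg (Subtype.val (p := (· ∈ algebraicClosure F E))) this)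
  have h2 : LinearIndepOn (FixedPoints.subfield (E ≃ₐ[algebraicClosure F E] E) E) id
      ((Finset.univ.image v : Finset E) : Set E) := by
    rw [Finset.coe_image, Finset.coe_univ, Set.image_univ]
    exact h1.linearIndepOn_id
  have h3 := FixedPoints.linearIndependent_smul_of_linearIndependent _ E h2
  exact h3.comp (fun i => ⟨v i, by simp⟩) fun i j hij => h1.injective (congrArg Subtype.val hij)

namespace PowerSeries

/-- If a combination of power series with algebraic coefficients is D-finite, and the multipliers are
linearly independent over the algebraic elements, then each series is D-finite: it is a linear
combination of the conjugates of the sum under the automorphisms fixing the algebraic elements. -/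
theorem DFinite.of_sum_C_mul {F E ι : Type*} [Field F] [Field E] [Algebra F E] [IsAlgClosed E]
    [Fintype ι] {c : ι → E} (hc : LinearIndependent (algebraicClosure F E) c)
    {y : ι → PowerSeries E} (hy : ∀ i n, IsAlgebraic F (coeff n (y i)))
    (h : DFinite (∑ i, C (c i) * y i)) (i : ι) : DFinite (y i) := by
  classical
  obtain ⟨a, ha⟩ := (linearIndependent_algEquiv_apply hc).exists_finsupp_eval_eq (Pi.single i 1)
  have hσ (σ : E ≃ₐ[algebraicClosure F E] E) (j : ι) : PowerSeries.map (σ : E →+* E) (y j) = y j := by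
    ext n
    exact σ.commutes ⟨_, mem_algebraicClosure_iff.2 (hy j n)⟩
  have key : y i = ∑ σ ∈ a.support, C (a σ) * PowerSeries.map (σ : E →+* E) (∑ j, C (c j) * y j) := by
    calc y i = ∑ j, C ((Pi.single i 1 : ι → E) j) * y j := by
          rw [Finset.sum_eq_single i]
          · simp
          · intro j _ hj
            simp [hj]
          · simp
      _ = ∑ j, ∑ σ ∈ a.support, C (a σ * σ (c j)) * y j := by
          refine Finset.sum_congr rfl fun j _ => ?_
          rw [← ha j, Finsupp.sum, map_sum, Finset.sum_mul]
      _ = _ := by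
          rw [Finset.sum_comm]
          refine Finset.sum_congr rfl fun σ _ => ?_
          rw [map_sum, Finset.mul_sum]
          refine Finset.sum_congr rfl fun j _ => ?_
          rw [map_mul (PowerSeries.map _), hσ, map_C, map_mul, mul_assoc]
          rfl
  rw [key]
  exact dfinite_sum _ _ fun σ _ => (dfinite_C _).mul (h.map _)

end PowerSeries

/-! ### Taylor series -/

/-- The Taylor series of `g` at `z₀`, as a formal power series. -/
noncomputable def taylorSeries (g : ℂ → ℂ) (z₀ : ℂ) : PowerSeries ℂ :=
  PowerSeries.mk fun n => iteratedDeriv n g z₀ / (n.factorial : ℂ)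

theorem taylorSeries_congr {g h : ℂ → ℂ} {z₀ : ℂ} (hgh : g =ᶠ[𝓝 z₀] h) :
    taylorSeries g z₀ = taylorSeries h z₀ := by
  ext n
  simp [taylorSeries, hgh.iteratedDeriv_eq]

theorem taylorSeries_zero (z₀ : ℂ) : taylorSeries 0 z₀ = 0 := by
  ext n
  simp [taylorSeries]

theorem taylorSeries_add {g h : ℂ → ℂ} {z₀ : ℂ} (hg : AnalyticAt ℂ g z₀) (hh : AnalyticAt ℂ h z₀) :
    taylorSeries (g + h) z₀ = taylorSeries g z₀ + taylorSeries h z₀ := by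
  ext n
  simp [taylorSeries, iteratedDeriv_add hg.contDiffAt hh.contDiffAt, add_div]

theorem taylorSeries_mul {g h : ℂ → ℂ} {z₀ : ℂ} (hg : AnalyticAt ℂ g z₀) (hh : AnalyticAt ℂ h z₀) :
    taylorSeries (g * h) z₀ = taylorSeries g z₀ * taylorSeries h z₀ := by
  ext n
  rw [PowerSeries.coeff_mul, Finset.Nat.sum_antidiagonal_eq_sum_range_succ_mk]
  simp only [taylorSeries, PowerSeries.coeff_mk]
  rw [iteratedDeriv_mul hg.contDiffAt hh.contDiffAt, Finset.sum_div]
  refine Finset.sum_congr rfl fun i hi => ?_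
  have hin : i ≤ n := Nat.lt_succ_iff.1 (Finset.mem_range.1 hi)
  rw [Nat.cast_choose ℂ hin]
  have := Nat.cast_ne_zero (R := ℂ).2 n.factorial_ne_zero
  have := Nat.cast_ne_zero (R := ℂ).2 i.factorial_ne_zero
  have := Nat.cast_ne_zero (R := ℂ).2 (n - i).factorial_ne_zero
  field_simp

theorem taylorSeries_sum {ι : Type*} (s : Finset ι) {g : ι → ℂ → ℂ} {z₀ : ℂ}
    (hg : ∀ i ∈ s, AnalyticAt ℂ (g i) z₀) :
    taylorSeries (∑ i ∈ s, g i) z₀ = ∑ i ∈ s, taylorSeries (g i) z₀ := by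
  ext n
  simp [taylorSeries, iteratedDeriv_sum fun i hi => (hg i hi).contDiffAt, Finset.sum_div]

theorem taylorSeries_deriv (g : ℂ → ℂ) (z₀ : ℂ) :
    taylorSeries (deriv g) z₀ = PowerSeries.derivative ℂ (taylorSeries g z₀) := by
  ext n
  have : ((n : ℂ) + 1) ≠ 0 := Nat.cast_add_one_ne_zero n
  have := Nat.cast_ne_zero (R := ℂ).2 n.factorial_ne_zero
  rw [PowerSeries.coeff_derivative]
  simp only [taylorSeries, PowerSeries.coeff_mk, iteratedDeriv_succ', Nat.factorial_succ,
    Nat.cast_mul, Nat.cast_add, Nat.cast_one]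
  field_simp

theorem taylorSeries_iteratedDeriv (g : ℂ → ℂ) (z₀ : ℂ) (i : ℕ) :
    taylorSeries (iteratedDeriv i g) z₀ = (PowerSeries.derivative ℂ)^[i] (taylorSeries g z₀) := by
  induction i with
  | zero => simp
  | succ i ih => rw [iteratedDeriv_succ, taylorSeries_deriv, ih, Function.iterate_succ_apply']

theorem taylorSeries_polynomial (p : Polynomial ℂ) (z₀ : ℂ) :
    taylorSeries (fun z => p.eval z) z₀ = (Polynomial.taylor z₀ p : Polynomial ℂ) := by
  ext n
  have h : ∀ q : Polynomial ℂ, iteratedDeriv n (fun z => q.eval z) =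
      fun z => (Polynomial.derivative^[n] q).eval z := by
    induction n with
    | zero => simp
    | succ n ih =>
      intro q
      have hq : deriv (fun z => q.eval z) = fun z => q.derivative.eval z :=
        funext fun z => q.deriv
      rw [iteratedDeriv_succ', hq, ih, Function.iterate_succ_apply]
  have := Nat.cast_ne_zero (R := ℂ).2 n.factorial_ne_zero
  rw [taylorSeries, PowerSeries.coeff_mk, Polynomial.coeff_coe, Polynomial.taylor_coeff, h,
    ← Polynomial.factorial_smul_hasseDeriv]
  simp [nsmul_eq_mul]
  field_simp

theorem eventuallyEq_zero_of_taylorSeries_eq_zero {g : ℂ → ℂ} {z₀ : ℂ} (hg : AnalyticAt ℂ g z₀)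
    (h : taylorSeries g z₀ = 0) : g =ᶠ[𝓝 z₀] 0 := by
  have h1 := hg.hasFPowerSeriesAt
  have h2 : (fun n : ℕ => iteratedDeriv n g z₀ / (n.factorial : ℂ)) = 0 := by
    funext n
    simpa [taylorSeries] using congrArg (PowerSeries.coeff n) h
  rw [h2, FormalMultilinearSeries.ofScalars_series_eq_zero_of_scalar_zero] at h1
  exact h1.eventually_eq_zero

theorem AnalyticAt.iteratedDeriv {g : ℂ → ℂ} {z₀ : ℂ} (hg : AnalyticAt ℂ g z₀) (i : ℕ) :
    AnalyticAt ℂ (iteratedDeriv i g) z₀ := by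
  rw [iteratedDeriv_eq_iterate]
  exact hg.iterated_deriv i

theorem analyticAt_sum_polynomial_mul {g : ℕ → ℂ → ℂ} {z₀ : ℂ} (hg : ∀ i, AnalyticAt ℂ (g i) z₀)
    (n : ℕ) (p : ℕ → Polynomial ℂ) :
    AnalyticAt ℂ (∑ i ∈ Finset.range (n + 1), (fun z => (p i).eval z) * g i) z₀ :=
  Finset.analyticAt_sum _ fun i _ => (AnalyticOnNhd.eval_polynomial (p i) z₀ trivial).mul (hg i)

theorem taylorSeries_differentialOperator {g : ℂ → ℂ} {z₀ : ℂ} (hg : AnalyticAt ℂ g z₀)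
    (n : ℕ) (p : ℕ → Polynomial ℂ) :
    taylorSeries (∑ i ∈ Finset.range (n + 1), (fun z => (p i).eval z) * iteratedDeriv i g) z₀ =
      ∑ i ∈ Finset.range (n + 1), (Polynomial.taylor z₀ (p i) : PowerSeries ℂ) *
        (PowerSeries.derivative ℂ)^[i] (taylorSeries g z₀) := by
  have hp (i : ℕ) : AnalyticAt ℂ (fun z => (p i).eval z) z₀ :=
    AnalyticOnNhd.eval_polynomial (p i) z₀ trivial
  rw [taylorSeries_sum _ fun i _ => (hp i).mul (hg.iteratedDeriv i)]
  refine Finset.sum_congr rfl fun i _ => ?_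
  rw [taylorSeries_mul (hp i) (hg.iteratedDeriv i), taylorSeries_polynomial,
    taylorSeries_iteratedDeriv]

/-- On a domain, being holonomic can be read off the Taylor series at any point: the equation of one
is that of the other, up to translating the coefficients by `z₀`. -/
theorem isHolonomicOn_iff_dfinite_taylorSeries {g : ℂ → ℂ} {U : Set ℂ} (hUo : IsOpen U)
    (hU : IsPreconnected U) {z₀ : ℂ} (hz₀ : z₀ ∈ U) (hg : AnalyticOnNhd ℂ g U) :
    IsHolonomicOn g U ↔ PowerSeries.DFinite (taylorSeries g z₀) := by
  constructor
  · rintro ⟨-, n, p, ⟨i, hi, hpi⟩, h⟩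
    refine ⟨n, fun i => Polynomial.taylor z₀ (p i), ⟨i, hi, by simpa using hpi⟩, ?_⟩
    rw [← taylorSeries_differentialOperator (hg z₀ hz₀), ← taylorSeries_zero z₀]
    refine taylorSeries_congr ?_
    filter_upwards [hUo.mem_nhds hz₀] with z hz
    simpa using h z hz
  · rintro ⟨n, q, ⟨i, hi, hqi⟩, h⟩
    refine ⟨hg, n, fun i => Polynomial.taylor (-z₀) (q i), ⟨i, hi, by simpa using hqi⟩, ?_⟩
    have h0 : taylorSeries (∑ i ∈ Finset.range (n + 1),
        (fun z => (Polynomial.taylor (-z₀) (q i)).eval z) * iteratedDeriv i g) z₀ = 0 := by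
      rw [taylorSeries_differentialOperator (hg z₀ hz₀), ← h]
      simp [Polynomial.taylor_taylor]
    have han : AnalyticOnNhd ℂ (∑ i ∈ Finset.range (n + 1),
        (fun z => (Polynomial.taylor (-z₀) (q i)).eval z) * iteratedDeriv i g) U := fun z hz =>
      analyticAt_sum_polynomial_mul (fun i => (hg z hz).iteratedDeriv i) n _
    intro z hz
    simpa using han.eqOn_zero_of_preconnected_of_eventuallyEq_zero hU hz₀
      (eventuallyEq_zero_of_taylorSeries_eq_zero (han z₀ hz₀) h0) hz

/-! ### Closure properties of holonomic functions -/

namespace IsHolonomicOn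

theorem congr {g h : ℂ → ℂ} {U : Set ℂ} (hUo : IsOpen U) (hg : IsHolonomicOn g U)
    (hgh : Set.EqOn g h U) : IsHolonomicOn h U := by
  obtain ⟨ha, n, p, hp, he⟩ := hg
  refine ⟨ha.congr hUo hgh, n, p, hp, fun z hz => ?_⟩
  have hev : h =ᶠ[𝓝 z] g := by
    filter_upwards [hUo.mem_nhds hz] with w hw using (hgh hw).symm
  simpa only [hev.iteratedDeriv_eq] using he z hz

theorem mono {g : ℂ → ℂ} {U V : Set ℂ} (hg : IsHolonomicOn g V) (hUV : U ⊆ V) :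
    IsHolonomicOn g U := by
  obtain ⟨ha, n, p, hp, he⟩ := hg
  exact ⟨ha.mono hUV, n, p, hp, fun z hz => he z (hUV hz)⟩

/-- Analytic continuation preserves holonomy: an equation satisfied on a non-empty open part of a
domain is satisfied on the whole domain. -/
theorem extend {g : ℂ → ℂ} {U V : Set ℂ} (hUo : IsOpen U) (hU : IsConnected U)
    (hVo : IsOpen V) (hV : IsPreconnected V) (hUV : U ⊆ V) (ha : AnalyticOnNhd ℂ g V) (hg : IsHolonomicOn g U) :
    IsHolonomicOn g V := by
  obtain ⟨z₀, hz₀⟩ := hU.nonempty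
  exact (isHolonomicOn_iff_dfinite_taylorSeries hVo hV (hUV hz₀) ha).2
    ((isHolonomicOn_iff_dfinite_taylorSeries hUo hU.isPreconnected hz₀ hg.1).1 hg)

variable {U : Set ℂ} {g h : ℂ → ℂ}

theorem add (hUo : IsOpen U) (hUc : IsConnected U) (hg : IsHolonomicOn g U)
    (hh : IsHolonomicOn h U) : IsHolonomicOn (fun z => g z + h z) U := by
  obtain ⟨z₀, hz₀⟩ := hUc.nonempty
  refine (isHolonomicOn_iff_dfinite_taylorSeries hUo hUc.isPreconnected hz₀ (hg.1.add hh.1)).2 ?_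
  rw [taylorSeries_add (hg.1 z₀ hz₀) (hh.1 z₀ hz₀)]
  exact ((isHolonomicOn_iff_dfinite_taylorSeries hUo hUc.isPreconnected hz₀ hg.1).1 hg).add
    ((isHolonomicOn_iff_dfinite_taylorSeries hUo hUc.isPreconnected hz₀ hh.1).1 hh)

theorem mul (hUo : IsOpen U) (hUc : IsConnected U) (hg : IsHolonomicOn g U)
    (hh : IsHolonomicOn h U) : IsHolonomicOn (fun z => g z * h z) U := by
  obtain ⟨z₀, hz₀⟩ := hUc.nonempty
  refine (isHolonomicOn_iff_dfinite_taylorSeries hUo hUc.isPreconnected hz₀ (hg.1.mul hh.1)).2 ?_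
  change (taylorSeries (g * h) z₀).DFinite
  rw [taylorSeries_mul (hg.1 z₀ hz₀) (hh.1 z₀ hz₀)]
  exact ((isHolonomicOn_iff_dfinite_taylorSeries hUo hUc.isPreconnected hz₀ hg.1).1 hg).mul
    ((isHolonomicOn_iff_dfinite_taylorSeries hUo hUc.isPreconnected hz₀ hh.1).1 hh)

theorem const (c : ℂ) (U : Set ℂ) : IsHolonomicOn (fun _ => c) U := by
  refine ⟨fun z _ => analyticAt_const, 1, fun i => if i = 1 then 1 else 0, ⟨1, le_rfl, by simp⟩,
    fun z _ => ?_⟩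
  simp [Finset.sum_range_succ]

theorem sum (hUo : IsOpen U) (hUc : IsConnected U) {ι : Type*} (s : Finset ι) {g : ι → ℂ → ℂ}
    (hg : ∀ i ∈ s, IsHolonomicOn (g i) U) : IsHolonomicOn (fun z => ∑ i ∈ s, g i z) U := by
  classical
  induction s using Finset.induction_on with
  | empty => simpa using const 0 U
  | insert a s ha ih =>
    simp only [Finset.sum_insert ha]
    exact add hUo hUc (hg a (by simp)) (ih fun i hi => hg i (by simp [hi]))

theorem pow (hUo : IsOpen U) (hUc : IsConnected U) (hg : IsHolonomicOn g U) (n : ℕ) :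
    IsHolonomicOn (fun z => g z ^ n) U := by
  induction n with
  | zero => simpa using const 1 U
  | succ n ih => simpa only [pow_succ] using ih.mul hUo hUc hg

end IsHolonomicOn

/-! ### Determinations of the logarithm -/

namespace IsLogDetermination

variable {ℓ : ℂ → ℂ} {U : Set ℂ}

theorem ne_zero (hℓ : IsLogDetermination ℓ U) {z : ℂ} (hz : z ∈ U) : z ≠ 0 :=
  hℓ.2 z hz ▸ Complex.exp_ne_zero _

theorem hasDerivAt (hℓ : IsLogDetermination ℓ U) (hUo : IsOpen U) {z : ℂ} (hz : z ∈ U) :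
    HasDerivAt ℓ z⁻¹ z := by
  have h := HasDerivAt.of_local_left_inverse (hℓ.1.continuousAt (hUo.mem_nhds hz))
    (Complex.hasDerivAt_exp (ℓ z)) (Complex.exp_ne_zero _)
    (by filter_upwards [hUo.mem_nhds hz] with w hw using hℓ.2 w hw)
  rwa [hℓ.2 z hz] at h

theorem analyticOnNhd (hℓ : IsLogDetermination ℓ U) (hUo : IsOpen U) : AnalyticOnNhd ℂ ℓ U :=
  DifferentiableOn.analyticOnNhd
    (fun _ hz => (hℓ.hasDerivAt hUo hz).differentiableAt.differentiableWithinAt) hUo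

theorem add_two_pi_mul_I_mul_nat (hℓ : IsLogDetermination ℓ U) (n : ℕ) :
    IsLogDetermination (fun z => ℓ z + n * (2 * Real.pi * Complex.I)) U :=
  ⟨hℓ.1.add continuousOn_const, fun z hz => by
    rw [Complex.exp_add, hℓ.2 z hz, Complex.exp_nat_mul_two_pi_mul_I, mul_one]⟩

/-- The logarithm satisfies `y' + z y'' = 0`. -/
theorem isHolonomicOn (hℓ : IsLogDetermination ℓ U) (hUo : IsOpen U) : IsHolonomicOn ℓ U := by
  refine ⟨hℓ.analyticOnNhd hUo, 2, fun i => if i = 1 then 1 else if i = 2 then Polynomial.X else 0,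
    ⟨1, by simp, by simp⟩, fun z hz => ?_⟩
  have h1 : deriv ℓ =ᶠ[𝓝 z] fun w => w⁻¹ := by
    filter_upwards [hUo.mem_nhds hz] with w hw using (hℓ.hasDerivAt hUo hw).deriv
  have h2 : iteratedDeriv 2 ℓ z = -(z ^ 2)⁻¹ := by
    rw [iteratedDeriv_succ, iteratedDeriv_one, h1.deriv_eq, deriv_inv]
  have hz0 := hℓ.ne_zero hz
  simp only [Finset.sum_range_succ, Finset.range_zero, Finset.sum_empty, h2, iteratedDeriv_one,
    h1.self_of_nhds]
  simp
  field_simp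
  ring

/-- The function `z ^ α` satisfies `z y' - α y = 0`. -/
theorem isHolonomicOn_exp_mul (hℓ : IsLogDetermination ℓ U) (hUo : IsOpen U) (α : ℂ) :
    IsHolonomicOn (fun z => Complex.exp (α * ℓ z)) U := by
  have hd {z : ℂ} (hz : z ∈ U) : HasDerivAt (fun z => Complex.exp (α * ℓ z))
      (Complex.exp (α * ℓ z) * (α * z⁻¹)) z := ((hℓ.hasDerivAt hUo hz).const_mul α).cexp
  refine ⟨DifferentiableOn.analyticOnNhd
      (fun z hz => (hd hz).differentiableAt.differentiableWithinAt) hUo,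
    1, fun i => if i = 1 then Polynomial.X else -Polynomial.C α,
    ⟨1, le_rfl, by simp⟩, fun z hz => ?_⟩
  have hz0 := hℓ.ne_zero hz
  simp [Finset.sum_range_succ, iteratedDeriv_one, (hd hz).deriv]
  field_simp
  ring

end IsLogDetermination

/-- The derivation `d/dz` written in the coordinate `w = log z`, that is, `e⁻ʷ d/dw`. -/
noncomputable def logCoordDeriv (F : ℂ → ℂ) (w : ℂ) : ℂ :=
  Complex.exp (-w) * deriv F w

theorem AnalyticOnNhd.iterate_logCoordDeriv {F : ℂ → ℂ} {H : Set ℂ} (hF : AnalyticOnNhd ℂ F H)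
    (i : ℕ) : AnalyticOnNhd ℂ (logCoordDeriv^[i] F) H := by
  induction i with
  | zero => exact hF
  | succ i ih =>
    rw [Function.iterate_succ_apply']
    intro w hw
    exact (analyticAt_id.neg.cexp).mul (ih w hw).deriv

/-- `logCoordDeriv` corresponds to `d/dz` under composition with any determination of `log`. -/
theorem iteratedDeriv_comp_log {F ℓ : ℂ → ℂ} {H U : Set ℂ} (hF : AnalyticOnNhd ℂ F H)
    (hUo : IsOpen U) (hℓ : IsLogDetermination ℓ U) (hm : Set.MapsTo ℓ U H) (i : ℕ) :
    Set.EqOn (iteratedDeriv i fun z => F (ℓ z)) (fun z => (logCoordDeriv^[i] F) (ℓ z)) U := by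
  induction i with
  | zero => intro z _; simp
  | succ i ih =>
    intro z hz
    have h1 : iteratedDeriv i (fun z => F (ℓ z)) =ᶠ[𝓝 z] fun z => (logCoordDeriv^[i] F) (ℓ z) := by
      filter_upwards [hUo.mem_nhds hz] with w hw using ih hw
    have h2 : HasDerivAt (fun z => (logCoordDeriv^[i] F) (ℓ z))
        (deriv (logCoordDeriv^[i] F) (ℓ z) * z⁻¹) z :=
      ((hF.iterate_logCoordDeriv i _ (hm hz)).differentiableAt.hasDerivAt).comp z
        (hℓ.hasDerivAt hUo hz)
    rw [iteratedDeriv_succ, h1.deriv_eq, h2.deriv, Function.iterate_succ_apply']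
    change _ = Complex.exp (-ℓ z) * deriv (logCoordDeriv^[i] F) (ℓ z)
    rw [Complex.exp_neg, hℓ.2 z hz, mul_comm]

/-- Holonomy does not depend on the branch: if `F` is holomorphic on a domain `H` and `F (log z)` is
holonomic for one determination of the logarithm with values in `H`, then it is for any other. The
equation, written in the coordinate `w = log z`, has coefficients depending on `exp w` only, and it
propagates to the whole of `H` by the identity theorem. -/
theorem IsHolonomicOn.comp_log_of_comp_log {F ℓ ℓ' : ℂ → ℂ} {H U : Set ℂ}
    (hF : AnalyticOnNhd ℂ F H) (hH : IsPreconnected H) (hUo : IsOpen U) (hU : U.Nonempty)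
    (hℓ : IsLogDetermination ℓ U) (hm : Set.MapsTo ℓ U H)
    (hℓ' : IsLogDetermination ℓ' U) (hm' : Set.MapsTo ℓ' U H)
    (h : IsHolonomicOn (fun z => F (ℓ z)) U) : IsHolonomicOn (fun z => F (ℓ' z)) U := by
  obtain ⟨-, n, p, hp, he⟩ := h
  obtain ⟨z₀, hz₀⟩ := hU
  set G : ℂ → ℂ := fun w => ∑ i ∈ Finset.range (n + 1),
    (p i).eval (Complex.exp w) * (logCoordDeriv^[i] F) w with hG
  have hGa : AnalyticOnNhd ℂ G H := by
    intro w hw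
    refine Finset.analyticAt_fun_sum _ fun i _ => AnalyticAt.mul ?_ (hF.iterate_logCoordDeriv i w hw)
    exact (AnalyticOnNhd.eval_polynomial (p i) (Complex.exp w) trivial).comp_of_eq
      (f := Complex.exp) analyticAt_cexp rfl
  have hGeq {k : ℂ → ℂ} (hk : IsLogDetermination k U) (hkm : Set.MapsTo k U H) {z : ℂ}
      (hz : z ∈ U) : G (k z) =
        ∑ i ∈ Finset.range (n + 1), (p i).eval z * iteratedDeriv i (fun z => F (k z)) z :=
    Finset.sum_congr rfl fun i _ => by
      rw [hk.2 z hz, iteratedDeriv_comp_log hF hUo hk hkm i hz]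
  -- `ℓ` is injective, hence `ℓ z` accumulates at `ℓ z₀` as `z` tends to `z₀`
  have htend : Tendsto ℓ (𝓝[≠] z₀) (𝓝[≠] (ℓ z₀)) := by
    refine tendsto_nhdsWithin_iff.2 ⟨(hℓ.1.continuousAt (hUo.mem_nhds hz₀)).mono_left
      nhdsWithin_le_nhds, ?_⟩
    filter_upwards [self_mem_nhdsWithin, mem_nhdsWithin_of_mem_nhds (hUo.mem_nhds hz₀)] with z hz hzU
    intro heq
    exact hz (by rw [Set.mem_singleton_iff, ← hℓ.2 z hzU, heq, hℓ.2 z₀ hz₀])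
  have hfreq : ∃ᶠ w in 𝓝[≠] (ℓ z₀), G w = 0 := by
    refine htend.frequently (Eventually.frequently ?_)
    filter_upwards [mem_nhdsWithin_of_mem_nhds (hUo.mem_nhds hz₀)] with z hz
    rw [hGeq hℓ hm hz, he z hz]
  have hG0 := hGa.eqOn_zero_of_preconnected_of_frequently_eq_zero hH (hm hz₀) hfreq
  refine ⟨fun z hz => ?_, n, p, hp, fun z hz => ?_⟩
  · exact (hF _ (hm' hz)).comp (hℓ'.analyticOnNhd hUo z hz)
  · rw [← hGeq hℓ' hm' hz]
    exact hG0 (hm' hz)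

/-! ### Separation of the powers and logarithms -/

theorem exp_mem_ball_zero_iff_re_lt_log {r : ℝ} (hr : 0 < r) (w : ℂ) :
    Complex.exp w ∈ Metric.ball 0 r ↔ w.re < Real.log r := by
  rw [mem_ball_zero_iff, Complex.norm_exp, Real.lt_log_iff_exp_lt hr]

/-- The `n`-th branch of `∑ z ^ α * log z ^ j * g α j` is an exponential polynomial in `n`, with the
exponentials `exp (2 * π * I * α)`. -/
theorem logSum_add_eq {A : Finset ℂ} {J : ℕ} (g : ℂ → ℕ → ℂ) (w : ℂ) (n : ℕ) :
    ∑ α ∈ A, ∑ j ∈ Finset.range (J + 1),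
      Complex.exp (α * (w + n * (2 * Real.pi * Complex.I))) *
        (w + n * (2 * Real.pi * Complex.I)) ^ j * g α j =
    ∑ x : A × Fin (J + 1), Complex.exp (2 * Real.pi * Complex.I * x.1) ^ n * (n : ℂ) ^ (x.2 : ℕ) *
      (Complex.exp (x.1 * w) * (2 * Real.pi * Complex.I) ^ (x.2 : ℕ) *
        ∑ j ∈ Finset.range (J + 1), (j.choose x.2 : ℂ) * w ^ (j - x.2) * g x.1 j) := by
  rw [Fintype.sum_prod_type, ← Finset.sum_coe_sort A]
  refine Finset.sum_congr rfl fun α _ => ?_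
  have hexp : Complex.exp (α * (w + n * (2 * Real.pi * Complex.I))) =
      Complex.exp (α * w) * Complex.exp (2 * Real.pi * Complex.I * α) ^ n := by
    rw [← Complex.exp_nat_mul, ← Complex.exp_add]
    congr 1
    ring
  have hpow (j : ℕ) (hj : j ∈ Finset.range (J + 1)) : (w + n * (2 * Real.pi * Complex.I)) ^ j =
      ∑ i ∈ Finset.range (J + 1),
        (n * (2 * Real.pi * Complex.I)) ^ i * w ^ (j - i) * (j.choose i : ℂ) := by
    rw [add_comm, add_pow]
    refine Finset.sum_subset (Finset.range_mono (Finset.mem_range.1 hj)) fun i _ hi => ?_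
    rw [Nat.choose_eq_zero_of_lt (by simpa using hi)]
    simp
  rw [Fin.sum_univ_eq_sum_range (fun i => Complex.exp (2 * Real.pi * Complex.I * α) ^ n *
    (n : ℂ) ^ i * (Complex.exp (α * w) * (2 * Real.pi * Complex.I) ^ i *
        ∑ j ∈ Finset.range (J + 1), (j.choose i : ℂ) * w ^ (j - i) * g α j)) (J + 1)]
  calc _ = ∑ j ∈ Finset.range (J + 1), ∑ i ∈ Finset.range (J + 1),
        Complex.exp (α * w) * Complex.exp (2 * Real.pi * Complex.I * α) ^ n *
          ((n * (2 * Real.pi * Complex.I)) ^ i * w ^ (j - i) * (j.choose i : ℂ)) * g α j := by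
        refine Finset.sum_congr rfl fun j hj => ?_
        rw [hexp, hpow j hj, Finset.mul_sum, Finset.sum_mul]
    _ = _ := by
        rw [Finset.sum_comm]
        refine Finset.sum_congr rfl fun i _ => ?_
        rw [Finset.mul_sum, Finset.mul_sum]
        refine Finset.sum_congr rfl fun j _ => ?_
        rw [mul_pow]
        ring

theorem injective_exp_two_pi_mul_I_mul {A : Finset ℂ}
    (hA : ∀ α ∈ A, ∀ α' ∈ A, (∃ m : ℤ, α - α' = (m : ℂ)) → α = α') :
    Function.Injective fun α : A => Complex.exp (2 * Real.pi * Complex.I * α) := by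
  rintro ⟨α, hα⟩ ⟨β, hβ⟩ h
  obtain ⟨m, hm⟩ := Complex.exp_eq_exp_iff_exists_int.1 h
  refine Subtype.ext (hA α hα β hβ ⟨m, ?_⟩)
  refine mul_left_cancel₀ Complex.two_pi_I_ne_zero ?_
  linear_combination hm

section

variable {A : Finset ℂ} {J : ℕ} {g : ℂ → ℕ → ℂ → ℂ} {ℓ : ℂ → ℂ} {U : Set ℂ}

theorem isHolonomicOn_logSum (hUo : IsOpen U) (hUc : IsConnected U) (hℓ : IsLogDetermination ℓ U)
    (hg : ∀ α ∈ A, ∀ j ≤ J, IsHolonomicOn (g α j) U) :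
    IsHolonomicOn (fun z => ∑ α ∈ A, ∑ j ∈ Finset.range (J + 1),
      Complex.exp (α * ℓ z) * ℓ z ^ j * g α j z) U :=
  .sum hUo hUc _ fun α hα => .sum hUo hUc _ fun j hj =>
    (((hℓ.isHolonomicOn_exp_mul hUo α).mul hUo hUc ((hℓ.isHolonomicOn hUo).pow hUo hUc j)).mul
      hUo hUc (hg α hα j (Nat.lt_succ_iff.1 (Finset.mem_range.1 hj))))

/-- The coefficients of a holonomic function `∑ z ^ α * log z ^ j * g α j` are holonomic, as long as
the exponents `α` are distinct modulo `ℤ`. -/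
theorem isHolonomicOn_of_logSum {r : ℝ} (hr : 0 < r)
    (hA : ∀ α ∈ A, ∀ α' ∈ A, (∃ m : ℤ, α - α' = (m : ℂ)) → α = α')
    (hg : ∀ α ∈ A, ∀ j ≤ J, AnalyticOnNhd ℂ (g α j) (Metric.ball 0 r))
    (hUo : IsOpen U) (hUc : IsConnected U) (hUr : U ⊆ Metric.ball 0 r)
    (hℓ : IsLogDetermination ℓ U)
    (h : IsHolonomicOn (fun z => ∑ α ∈ A, ∑ j ∈ Finset.range (J + 1),
      Complex.exp (α * ℓ z) * ℓ z ^ j * g α j z) U) :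
    ∀ α ∈ A, ∀ j ≤ J, IsHolonomicOn (g α j) U := by
  classical
  set F : ℂ → ℂ := fun w => ∑ α ∈ A, ∑ j ∈ Finset.range (J + 1),
    Complex.exp (α * w) * w ^ j * g α j (Complex.exp w) with hF
  set H : Set ℂ := {w | w.re < Real.log r} with hH
  have hFa : AnalyticOnNhd ℂ F H := by
    intro w hw
    refine Finset.analyticAt_fun_sum _ fun α hα => Finset.analyticAt_fun_sum _ fun j hj => ?_
    refine AnalyticAt.mul ?_ ?_
    · exact (analyticAt_const.mul analyticAt_id).cexp.mul (analyticAt_id.pow j)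
    · exact (hg α hα j (Nat.lt_succ_iff.1 (Finset.mem_range.1 hj)) _
        ((exp_mem_ball_zero_iff_re_lt_log hr w).2 hw)).comp_of_eq analyticAt_cexp rfl
  have hHc : IsPreconnected H := (convex_halfSpace_re_lt (Real.log r)).isPreconnected
  have hmaps {k : ℂ → ℂ} (hk : IsLogDetermination k U) : Set.MapsTo k U H := fun z hz =>
    (exp_mem_ball_zero_iff_re_lt_log hr _).1 (by rw [hk.2 z hz]; exact hUr hz)
  have hFℓ : IsHolonomicOn (fun z => F (ℓ z)) U := h.congr hUo fun z hz => by
    simp only [hF, hℓ.2 z hz]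
  -- all the branches of `z ↦ F (log z)` are holonomic
  have hbranch (n : ℕ) : IsHolonomicOn
      (fun z => F (ℓ z + n * (2 * Real.pi * Complex.I))) U :=
    hFℓ.comp_log_of_comp_log hFa hHc hUo hUc.nonempty hℓ (hmaps hℓ)
      (hℓ.add_two_pi_mul_I_mul_nat n) (hmaps (hℓ.add_two_pi_mul_I_mul_nat n))
  -- by interpolation in `n`, so are the coefficients of their expansion in `μ ^ n * n ^ i`
  have hQ (α : ℂ) (hα : α ∈ A) (i : ℕ) (hi : i ≤ J) : IsHolonomicOn (fun z =>
      Complex.exp (α * ℓ z) * (2 * Real.pi * Complex.I) ^ i *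
        ∑ j ∈ Finset.range (J + 1), (j.choose i : ℂ) * ℓ z ^ (j - i) * g α j z) U := by
    let x₀ : A × Fin (J + 1) := (⟨α, hα⟩, ⟨i, Nat.lt_succ_of_le hi⟩)
    obtain ⟨c, hc⟩ := (linearIndependent_pow_mul_pow
      (fun α : A => Complex.exp (2 * Real.pi * Complex.I * α))
      (injective_exp_two_pi_mul_I_mul hA) (fun _ => Complex.exp_ne_zero _)
      (J + 1)).exists_finsupp_eval_eq (Pi.single x₀ 1)
    refine IsHolonomicOn.congr hUo (IsHolonomicOn.sum hUo hUc c.support fun n _ =>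
      (IsHolonomicOn.const (c n) U).mul hUo hUc (hbranch n)) fun z hz => ?_
    have hFn (n : ℕ) := logSum_add_eq (A := A) (J := J) (fun α j => g α j z) (ℓ z) n
    have hz' (n : ℕ) : Complex.exp (ℓ z + n * (2 * Real.pi * Complex.I)) = z :=
      (hℓ.add_two_pi_mul_I_mul_nat n).2 z hz
    simp only [hF, hz', hFn, Finset.mul_sum (s := Finset.univ)]
    rw [Finset.sum_comm]
    have hc' (x : A × Fin (J + 1)) (y : ℂ) : ∑ n ∈ c.support, c n *
        (Complex.exp (2 * Real.pi * Complex.I * x.1) ^ n * (n : ℂ) ^ (x.2 : ℕ) * y) =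
          (Pi.single x₀ 1 : A × Fin (J + 1) → ℂ) x * y := by
      rw [← hc x, Finsupp.sum, Finset.sum_mul]
      exact Finset.sum_congr rfl fun _ _ => (mul_assoc _ _ _).symm
    simp only [hc']
    rw [Finset.sum_eq_single x₀]
    · simp [x₀]
    · intro x _ hx
      rw [Pi.single_eq_of_ne hx, zero_mul]
    · simp
  -- these coefficients form a triangular system in the `g α j`: descending induction on `j`
  intro α hα j hj
  induction hd : J - j using Nat.strong_induction_on generalizing j with
  | _ d ih =>
  subst hd
  have hpi : (2 * Real.pi * Complex.I) ^ j ≠ 0 := pow_ne_zero _ Complex.two_pi_I_ne_zero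
  have hrest : IsHolonomicOn (fun z => ∑ k ∈ (Finset.range (J + 1)).erase j,
      (k.choose j : ℂ) * ℓ z ^ (k - j) * g α k z) U := by
    refine .sum hUo hUc _ fun k hk => ?_
    obtain ⟨hkj, hk⟩ := Finset.mem_erase.1 hk
    have hkJ : k ≤ J := Nat.lt_succ_iff.1 (Finset.mem_range.1 hk)
    rcases lt_or_gt_of_ne hkj with hlt | hgt
    · simpa [Nat.choose_eq_zero_of_lt hlt] using IsHolonomicOn.const 0 U
    · exact ((IsHolonomicOn.const _ U).mul hUo hUc
        ((hℓ.isHolonomicOn hUo).pow hUo hUc _)).mul hUo hUc (ih (J - k) (by omega) k hkJ rfl)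
  have hmain := (((IsHolonomicOn.const ((2 * Real.pi * Complex.I) ^ j)⁻¹ U).mul hUo hUc
    (hℓ.isHolonomicOn_exp_mul hUo (-α))).mul hUo hUc (hQ α hα j hj)).add hUo hUc
      ((IsHolonomicOn.const (-1) U).mul hUo hUc hrest)
  refine hmain.congr hUo fun z hz => ?_
  have hsplit := Finset.add_sum_erase (Finset.range (J + 1))
    (fun k => (k.choose j : ℂ) * ℓ z ^ (k - j) * g α k z)
    (Finset.mem_range.2 (Nat.lt_succ_of_le hj))
  simp only [Nat.choose_self, Nat.cast_one, Nat.sub_self, pow_zero, one_mul] at hsplit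
  have hexp : Complex.exp (α * ℓ z) ≠ 0 := Complex.exp_ne_zero _
  simp only [← hsplit, neg_mul, Complex.exp_neg]
  field_simp
  ring

end

theorem isHolonomicOn_of_sum_const_mul {ι : Type*} [Fintype ι] {r : ℝ} (hr : 0 < r)
    {c : ι → ℂ} (hc : LinearIndependent (algebraicClosure ℚ ℂ) c) {f : ι → ℂ → ℂ}
    (hf : ∀ k, AnalyticOnNhd ℂ (f k) (Metric.ball 0 r))
    (hcoeff : ∀ k, ∀ n : ℕ, IsAlgebraic ℚ (iteratedDeriv n (f k) 0 / (n.factorial : ℂ)))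
    (h : IsHolonomicOn (fun z => ∑ k, c k * f k z) (Metric.ball 0 r)) (k : ι) :
    IsHolonomicOn (f k) (Metric.ball 0 r) := by
  have h0 : (0 : ℂ) ∈ Metric.ball 0 r := Metric.mem_ball_self hr
  have hpre : IsPreconnected (Metric.ball (0 : ℂ) r) := (convex_ball 0 r).isPreconnected
  rw [isHolonomicOn_iff_dfinite_taylorSeries Metric.isOpen_ball hpre h0 h.1] at h
  rw [isHolonomicOn_iff_dfinite_taylorSeries Metric.isOpen_ball hpre h0 (hf k)]
  refine PowerSeries.DFinite.of_sum_C_mul (F := ℚ) hc (y := fun k => taylorSeries (f k) 0)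
    (fun k n => by simpa [taylorSeries] using hcoeff k n) ?_ k
  convert h using 1
  ext n
  have : (fun z => ∑ k, c k * f k z) = ∑ k, fun z => c k * f k z := by
    funext z
    simp
  rw [this, taylorSeries_sum (g := fun k z => c k * f k z) _ fun k _ => analyticAt_const.mul (hf k 0 h0)]
  simp [taylorSeries, mul_div_assoc]

theorem proposition5
    (J : ℕ) (A : Finset ℂ)
    (hA : ∀ α ∈ A, ∀ α' ∈ A, (∃ m : ℤ, α - α' = (m : ℂ)) → α = α')
    (K : ℂ → ℕ → ℕ)
    (f : (α : ℂ) → (j : ℕ) → Fin (K α j) → ℂ → ℂ)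
    (lam : (α : ℂ) → (j : ℕ) → Fin (K α j) → ℂ)
    -- a common disc of holomorphy of the finitely many functions `f α j k`
    (r : ℝ) (hr : 0 < r)
    (hf : ∀ α ∈ A, ∀ j ≤ J, ∀ k, AnalyticOnNhd ℂ (f α j k) (Metric.ball 0 r))
    -- the Taylor coefficients at `0` are algebraic numbers
    (hcoeff : ∀ α ∈ A, ∀ j ≤ J, ∀ k, ∀ n : ℕ,
      IsAlgebraic ℚ (iteratedDeriv n (f α j k) 0 / (n.factorial : ℂ)))
    (hlam : ∀ α ∈ A, ∀ j ≤ J, LinearIndependent (algebraicClosure ℚ ℂ) (lam α j))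
    -- a domain in the punctured disc with a determination `ℓ` of the logarithm on it
    (U : Set ℂ) (hUo : IsOpen U) (hUc : IsConnected U) (hUr : U ⊆ Metric.ball 0 r)
    (ℓ : ℂ → ℂ) (hℓ : IsLogDetermination ℓ U) :
    IsHolonomicOn
        (fun z => ∑ α ∈ A, ∑ j ∈ Finset.range (J + 1), ∑ k : Fin (K α j),
          lam α j k * Complex.exp (α * ℓ z) * ℓ z ^ j * f α j k z) U ↔
      ∀ α ∈ A, ∀ j ≤ J, ∀ k, IsHolonomicOn (f α j k) (Metric.ball 0 r) := by
  have hD : IsConnected (Metric.ball (0 : ℂ) r) :=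
    ⟨⟨0, Metric.mem_ball_self hr⟩, (convex_ball 0 r).isPreconnected⟩
  have hsum : (fun z => ∑ α ∈ A, ∑ j ∈ Finset.range (J + 1), ∑ k : Fin (K α j),
      lam α j k * Complex.exp (α * ℓ z) * ℓ z ^ j * f α j k z) =
    fun z => ∑ α ∈ A, ∑ j ∈ Finset.range (J + 1), Complex.exp (α * ℓ z) * ℓ z ^ j *
      ∑ k : Fin (K α j), lam α j k * f α j k z := by
    funext z
    refine Finset.sum_congr rfl fun α _ => Finset.sum_congr rfl fun j _ => ?_
    rw [Finset.mul_sum]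
    exact Finset.sum_congr rfl fun k _ => by ring
  rw [hsum]
  constructor
  · intro h α hα j hj
    have hg : ∀ α ∈ A, ∀ j ≤ J, AnalyticOnNhd ℂ
        (fun z => ∑ k : Fin (K α j), lam α j k * f α j k z) (Metric.ball 0 r) :=
      fun α hα j hj z hz => Finset.analyticAt_fun_sum _ fun k _ =>
        analyticAt_const.mul (hf α hα j hj k z hz)
    have hU := isHolonomicOn_of_logSum
      (g := fun α j z => ∑ k : Fin (K α j), lam α j k * f α j k z)
      hr hA hg hUo hUc hUr hℓ h α hα j hj
    exact isHolonomicOn_of_sum_const_mul hr (hlam α hα j hj) (hf α hα j hj) (hcoeff α hα j hj)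
      (hU.extend hUo hUc Metric.isOpen_ball hD.isPreconnected hUr (hg α hα j hj))
  · intro h
    refine isHolonomicOn_logSum (g := fun α j z => ∑ k : Fin (K α j), lam α j k * f α j k z)
      hUo hUc hℓ fun α hα j hj => ?_
    exact .sum hUo hUc _ fun k _ =>
      (IsHolonomicOn.const _ U).mul hUo hUc ((h α hα j hj k).mono hUr)
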